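/- **Setup.** Given a chessboard with $2p+1$ rows, $2q+1$ columns and black corners, the Aztec rectangle $AR_{p,q}$ (height $p$, width $q$) consists of its white squares, and the odd Aztec rectangle $O_{p,q}$ of its black squares. As graphs, two of these squares are adjacent if they share a corner; equivalently, they are regarded as lattice regions, namely unions of unit squares of a square lattice tilted by $45^\circ$, whose planar duals are these graphs. $\mathrm{M}$ denotes the number of domino tilings of a region, or the number of perfect matchings of a graph. Let $m$ be even, $s\ge 1$, let $a_1,\dots,a_s$ be integers, put $a=\sum_{i=1}^s(a_i+1)$, and assume $m-a>0$. Let $k$ be an integer with $0<k\le\min_i a_i$. The frame is $AR_{m,m-a}$; let $\ell$ be its horizontal symmetry axis and $\ell'$ the translate of $\ell$ by one unit southeast (the row of cells just below $\ell$). Label the $m-a+1$ cells of the frame on $\ell'$ from left to right by $1,\dots,m-a+1$, and use these labels as coordinates on $\ell'$. For a set $T\subset\{1,\dots,m-a+1\}$, let $R'''(m,m-a;T)$ be the graph obtained from the graph $AR_{m,m-a}$ by deleting all vertices on $\ell'$ whose labels are not in $T$. For each $i$ let $c_i$ be an integer if $a_i$ is even, and half of an odd integer if $a_i$ is odd, and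 let $A_i^{(c_i)}$ be the set of $a_i+1$ consecutive integers centered at $c_i$. Assume that the sets $A_i^{(c_i)}$ are contained in $\{1,\dots,m-a+1\}$ and are mutually disjoint. For $0\le j\le\min_i a_i$, let $$AR'''_{m-j,m-a-j}\setminus O_{j,a_1-j}^{(c_1)}\cup\cdots\cup O_{j,a_s-j}^{(c_s)}$$ be the region obtained from the Aztec rectangle region $AR_{m-j,m-a-j}$ centered inside the frame by removing, for each $i$, the copy of $O_{j,a_i-j}$ centered at the point of $\ell'$ with coordinate $c_i$. **Theorem.** Under these assumptions, $$\mathrm{M}\left(AR'''_{m-k,m-a-k}\setminus O_{k,a_1-k}^{(c_1)}\cup\cdots\cup O_{k,a_s-k}^{(c_s)}\right) =2^{\binom{k+1}{2}(s+1)-k(m+1)}\,\mathrm{M}\left(AR'''_{m,m-a}\setminus O_{0,a_1}^{(c_1)}\cup\cdots\cup O_{0,a_s}^{(c_s)}\right)$$ $$=2^{\binom{k+1}{2}(s+1)-k(m+1)}\,\mathrm{M}\left(R'''\left(m,m-a;\{1,\dots,m-a+1\}\setminus\left(A_1^{(c_1)}\cup\cdots\cup A_s^{(c_s)}\right)\right)\right).$$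 -/

import Mathlib

namespace OddWindows

/-- A square of the infinite chessboard, given by its column and row (columns increase to the
right, rows increase upwards).  The squares of one chessboard colour are also used as the vertices
of the Aztec rectangle graphs and, equivalently, as the unit squares of a square lattice tilted by
45 degrees: the chessboard square `p` stands for the tilted unit square centred at `p` whose
corners are the centres of the four chessboard squares that share a side with `p`. -/
abbrev Cell := ℤ × ℤ

/-- Two chessboard squares are adjacent if they share exactly a corner; in terms of the tilted
lattice, the two tilted unit squares share a side.  (Two squares of the same colour share a corner
if and only if they are diagonal neighbours.) -/
def cornerGraph : SimpleGraph Cell where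
  Adj p q := |p.1 - q.1| = 1 ∧ |p.2 - q.2| = 1
  symm := ⟨fun p q h => by rwa [abs_sub_comm p.1, abs_sub_comm p.2] at h⟩
  loopless := ⟨fun p h => by simp at h⟩

/-- The squares of the chessboard of `2 * m + 1` rows and `2 * n + 1` columns, centred at `z`. -/
noncomputable def board (z : Cell) (m n : ℕ) : Finset Cell :=
  Finset.Icc (z.1 - n) (z.1 + n) ×ˢ Finset.Icc (z.2 - m) (z.2 + m)

/-- The Aztec rectangle of height `m` and width `n` centred at `z`: the white squares of a
chessboard with `2 * m + 1` rows, `2 * n + 1` columns and black corners. -/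
noncomputable def aztecRect (z : Cell) (m n : ℕ) : Finset Cell :=
  (board z m n).filter fun p => Odd ((p.1 - (z.1 - n)) + (p.2 - (z.2 - m)))

/-- The odd Aztec rectangle of height `m` and width `n` centred at `z`: the black squares
of the same chessboard. -/
noncomputable def oddAztecRect (z : Cell) (m n : ℕ) : Finset Cell :=
  (board z m n).filter fun p => Even ((p.1 - (z.1 - n)) + (p.2 - (z.2 - m)))

/-- `D` is a tiling of the region `R` by dominoes, a domino being the union of two unit squares
of the tilted lattice that share a side: all dominoes of `D` lie in `R`, and every unit square
of `R` is covered by exactly one of them. -/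
def IsDominoTiling (R : Finset Cell) (D : Finset (Finset Cell)) : Prop :=
  (∀ d ∈ D, ∃ p ∈ R, ∃ q ∈ R, cornerGraph.Adj p q ∧ d = {p, q}) ∧
    ∀ p ∈ R, ∃! d, d ∈ D ∧ p ∈ d

/-- The number of domino tilings of a region. -/
noncomputable def numTilings (R : Finset Cell) : ℕ :=
  Nat.card {D : Finset (Finset Cell) // IsDominoTiling R D}

/-- The number of perfect matchings of a graph. -/
noncomputable def numPerfectMatchings {V : Type*} (G : SimpleGraph V) : ℕ :=
  Nat.card {M : G.Subgraph // M.IsPerfectMatching}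

/-! The frame is the Aztec rectangle of even height `m` and of width `n < m`, centred at `(0, 0)`.
Its horizontal symmetry axis `ℓ` is row `0`, and the translate `ℓ'` of `ℓ` by one unit of the tilted
lattice to the southeast is row `-1`.  The cells of the frame on `ℓ'` are those in the columns
`-n, -n + 2, …, n`; they are labelled `1, 2, …, n + 1` from left to right, so that label `t` is in
column `2 * (t - 1) - n`. -/

/-- The vertex set of `R'''(m, n; T)`: all vertices of the Aztec rectangle graph except the ones
on `ℓ'` with label not in `T`. -/
noncomputable def graphRVerts (m n : ℕ) (T : Finset ℤ) : Finset Cell :=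
  (aztecRect (0, 0) m n).filter fun p => p.2 = -1 → ∃ t ∈ T, p.1 = 2 * (t - 1) - n

/-- The graph `R'''(m, n; T)`. -/
def graphR (m n : ℕ) (T : Finset ℤ) : SimpleGraph (graphRVerts m n T) :=
  cornerGraph.induce (graphRVerts m n T : Set Cell)

/-- The integers at distance at most `a / 2` from `c`.  If `c - a / 2` is an integer, this is the
set of the `a + 1` consecutive integers centred at `c`. -/
noncomputable def run (a : ℕ) (c : ℚ) : Finset ℤ :=
  Finset.Icc ⌈c - a / 2⌉ ⌊c + a / 2⌋

/-- The point of `ℓ'` with coordinate `c`, where `2 * c` is an integer and the coordinates on `ℓ'`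
are the ones given by the labels of the frame of width `n` (the floor only casts to `ℤ`). -/
noncomputable def pointOn (n : ℕ) (c : ℚ) : Cell := (⌊2 * (c - 1)⌋ - n, -1)

/-- The Aztec rectangle region with odd windows
`AR'''_{m-k,n-k} \ O_{k,a_1-k}^{(c_1)} ∪ ⋯ ∪ O_{k,a_s-k}^{(c_s)}`, where the frame has height `m`
and width `n`: the outer Aztec rectangle is centred inside the frame, and the `i`-th window is
centred at the point of `ℓ'` that has coordinate `c i`. -/
noncomputable def windowRegion (m n k : ℕ) {s : ℕ} (a : Fin s → ℕ) (c : Fin s → ℚ) : Finset Cell :=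
  aztecRect (0, 0) (m - k) (n - k) \
    Finset.univ.biUnion fun i => oddAztecRect (pointOn n (c i)) k (a i - k)

end OddWindows

/-! The engine is complementation over a family of edge-disjoint 4-cycles, called cells. Suppose
every edge of two induced subgraphs, on `V` and `V'`, lies in a cell, and every vertex lies in as
many cells as it lies in sets among `V`, `V'`. A matching of `V` covers a set `S` of vertices in
each cell; replacing every `S` by its complement in the cell gives covering data for `V'`. Within
one cell the numbers of matchings on `Sᶜ` and on `S` have ratio `2 ^ (1 - #S / 2)`, or both vanish
(`card_cycleMatchings_compl`). The product over all cells depends only on `#C` and `#V`, which is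
`numTilings_compl`.

Take for `V` the frame of order `j` with its windows removed, and for the cell centres one parity
class of squares strictly inside the frame and outside the window boxes. Then `V'` is the region of
order `j + 1` (`holeyCells_degree`): the outer boundary moves in by one on every side, while each
window becomes one unit taller and one unit narrower at either end. The step multiplies the count by
`2 ^ (j + s * (j + 1) - m)` (`two_mul_card_holeyCells`), and these exponents are summed over `j <
k`. At `j = 0` the windows are just the runs of deleted vertices on `ℓ'`, and tilings of a region
are perfect matchings of its dual graph. -/

namespace OddWindows

open Finset

/-! ### Matchings within a single 4-cycle. -/

section CellMatchings

/-- The perfect matchings of the subgraph of a 4-cycle induced by `S`.  Vertices are numbered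
cyclically, and edge `e` joins the vertices `e` and `e + 1`. -/
def cycleMatchings (S : Finset (Fin 4)) : Finset (Finset (Fin 4)) :=
  univ.filter fun H => ∀ i, #{e ∈ H | i = e ∨ i = e + 1} = if i ∈ S then 1 else 0

/-- The first case consists of the sets of odd size and the pairs of opposite vertices; both classes
are closed under complement. -/
lemma card_cycleMatchings_compl_nat (S : Finset (Fin 4)) :
    (#(cycleMatchings Sᶜ) = 0 ∧ #(cycleMatchings S) = 0) ∨
      (#S = 0 ∧ #(cycleMatchings Sᶜ) = 2 ∧ #(cycleMatchings S) = 1) ∨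
      (#S = 2 ∧ #(cycleMatchings Sᶜ) = 1 ∧ #(cycleMatchings S) = 1) ∨
      (#S = 4 ∧ #(cycleMatchings Sᶜ) = 1 ∧ #(cycleMatchings S) = 2) := by
  revert S
  decide

/-- The weight `√2 ^ #S` is multiplicative over cells, so the product over all cells sees only the
total number of covered vertices. -/
lemma card_cycleMatchings_compl (S : Finset (Fin 4)) :
    (#(cycleMatchings Sᶜ) : ℝ) * √2 ^ #S = 2 * #(cycleMatchings S) := by
  have h2 : √2 ^ 2 = (2 : ℝ) := Real.sq_sqrt (by norm_num)
  have h4 : √2 ^ 4 = (4 : ℝ) := by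
    rw [show (4 : ℕ) = 2 * 2 from rfl, pow_mul, h2]; norm_num
  rcases card_cycleMatchings_compl_nat S with ⟨h, h'⟩ | ⟨h₀, h, h'⟩ | ⟨h₀, h, h'⟩ | ⟨h₀, h, h'⟩
  · rw [h, h']; simp
  · rw [h₀, h, h']; simp
  · rw [h₀, h, h', h2]; simp
  · rw [h₀, h, h', h4]; norm_num

end CellMatchings

/-! ### Complementation for an abstract family of 4-cycles. -/

section Complementation

variable {ι W : Type*} [DecidableEq W]

/-- The vertices selected by `A`, a set of vertices of each cell, cover every vertex in `V` exactly
once, and no other vertex. -/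
def IsExactCover [Fintype ι] (nbr : ι × Fin 4 → W) (V : Finset W) (A : ι → Finset (Fin 4)) : Prop :=
  ∀ v, #{x : ι × Fin 4 | x.2 ∈ A x.1 ∧ nbr x = v} = if v ∈ V then 1 else 0

/-- The number of perfect matchings on `V` that consist of edges of the given 4-cycles, sorted by
the set of vertices that each 4-cycle covers. -/
noncomputable def matchingSum [Fintype ι] (nbr : ι × Fin 4 → W) (V : Finset W) : ℕ :=
  open Classical in ∑ A with IsExactCover nbr V A, ∏ c, #(cycleMatchings (A c))

/-- The incidences of `v` with cells split into selected and unselected ones; subtracting the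
selected ones from the total leaves the indicator of `V'`. -/
lemma IsExactCover.compl [Fintype ι] {nbr : ι × Fin 4 → W} {V V' : Finset W}
    (h : ∀ v, #{x : ι × Fin 4 | nbr x = v} = (if v ∈ V then 1 else 0) + if v ∈ V' then 1 else 0)
    {A : ι → Finset (Fin 4)} (hA : IsExactCover nbr V A) :
    IsExactCover nbr V' fun c => (A c)ᶜ := by
  intro v
  have h1 := hA v
  have h2 := h v
  rw [← card_filter_add_card_filter_not (fun x : ι × Fin 4 => x.2 ∈ A x.1), filter_filter,
    filter_filter] at h2
  simp only [mem_compl]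
  simp only [and_comm (a := nbr _ = v)] at h2
  omega

lemma IsExactCover.sum_card [Fintype ι] {nbr : ι × Fin 4 → W} {V : Finset W} {A : ι → Finset (Fin 4)}
    (hA : IsExactCover nbr V A) : ∑ c, #(A c) = #V := by
  have h1 : ∑ c, #(A c) = #{x : ι × Fin 4 | x.2 ∈ A x.1} := by
    simp only [card_eq_sum_ones, sum_filter, ← univ_product_univ, sum_product]
    refine sum_congr rfl fun c _ => ?_
    rw [← sum_filter]; congr 1; ext; simp
  rw [h1, card_eq_sum_card_fiberwise (f := nbr) (t := V)]
  · rw [card_eq_sum_ones]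
    refine sum_congr rfl fun v hv => ?_
    have := hA v
    rwa [if_pos hv, ← filter_filter] at this
  · intro x hx
    by_contra hv
    have := hA (nbr x)
    rw [if_neg (by simpa using hv), card_eq_zero] at this
    have hx' : x ∈ ({y : ι × Fin 4 | y.2 ∈ A y.1 ∧ nbr y = nbr x} : Finset _) := by
      simpa using hx
    rw [this] at hx'
    simp at hx'

/-- The complementation theorem, for a family of 4-cycles. -/
lemma matchingSum_compl [Fintype ι] (nbr : ι × Fin 4 → W) (V V' : Finset W)
    (h : ∀ v, #{x : ι × Fin 4 | nbr x = v} =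
      (if v ∈ V then 1 else 0) + if v ∈ V' then 1 else 0) :
    (matchingSum nbr V' : ℝ) * √2 ^ #V = 2 ^ Fintype.card ι * matchingSum nbr V := by
  classical
  have h' : ∀ v, #{x : ι × Fin 4 | nbr x = v} =
      (if v ∈ V' then 1 else 0) + if v ∈ V then 1 else 0 := fun v => by rw [h v, add_comm]
  have hre : matchingSum nbr V' =
      ∑ A with IsExactCover nbr V A, ∏ c, #(cycleMatchings (A c)ᶜ) := by
    refine sum_nbij' (fun A c => (A c)ᶜ) (fun A c => (A c)ᶜ) ?_ ?_ ?_ ?_ ?_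
    · intro A hA
      simp only [mem_filter, mem_univ, true_and] at hA ⊢
      exact hA.compl h'
    · intro A hA
      simp only [mem_filter, mem_univ, true_and] at hA ⊢
      exact hA.compl h
    all_goals simp
  rw [hre, matchingSum]
  push_cast
  rw [sum_mul, mul_sum]
  refine sum_congr rfl fun A hA => ?_
  simp only [mem_filter, mem_univ, true_and] at hA
  rw [← hA.sum_card, ← prod_pow_eq_pow_sum, ← prod_mul_distrib, ← card_univ, ← prod_const,
    ← prod_mul_distrib]
  exact prod_congr rfl fun c _ => card_cycleMatchings_compl (A c)

/-- Edge `x.2` of the 4-cycle `x.1`. -/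
def cycleEdge (nbr : ι × Fin 4 → W) (x : ι × Fin 4) : Finset W :=
  {nbr x, nbr (x.1, x.2 + 1)}

lemma mem_cycleEdge {nbr : ι × Fin 4 → W} {x : ι × Fin 4} {v : W} :
    v ∈ cycleEdge nbr x ↔ ∃ i, (i = x.2 ∨ i = x.2 + 1) ∧ nbr (x.1, i) = v := by
  simp [cycleEdge, or_and_right, exists_or, eq_comm]

/-- A choice of edges of the 4-cycles is a perfect matching on `V`. -/
def IsCycleTiling (nbr : ι × Fin 4 → W) (V : Finset W) (H : ι → Finset (Fin 4)) : Prop :=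
  (∀ x : ι × Fin 4, x.2 ∈ H x.1 → cycleEdge nbr x ⊆ V) ∧
    ∀ v ∈ V, ∃! x : ι × Fin 4, x.2 ∈ H x.1 ∧ v ∈ cycleEdge nbr x

lemma isExactCover_iff [Fintype ι] {nbr : ι × Fin 4 → W} {V : Finset W} {A : ι → Finset (Fin 4)} :
    IsExactCover nbr V A ↔ (∀ x : ι × Fin 4, x.2 ∈ A x.1 → nbr x ∈ V) ∧
      ∀ v ∈ V, ∃! x : ι × Fin 4, x.2 ∈ A x.1 ∧ nbr x = v := by
  constructor
  · intro h
    refine ⟨fun x hx => ?_, fun v hv => ?_⟩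
    · by_contra hv
      have := h (nbr x)
      rw [if_neg hv, card_eq_zero, filter_eq_empty_iff] at this
      exact this (mem_univ x) ⟨hx, rfl⟩
    · have := h v
      rw [if_pos hv, card_eq_one] at this
      obtain ⟨x, hx⟩ := this
      refine ⟨x, ?_, fun y hy => ?_⟩
      · have : x ∈ ({x} : Finset (ι × Fin 4)) := mem_singleton_self x
        rw [← hx] at this
        simpa using this
      · rw [← mem_singleton, ← hx]; simpa using hy
  · rintro ⟨h1, h2⟩ v
    split_ifs with hv
    · obtain ⟨x, hx, hu⟩ := h2 v hv
      rw [card_eq_one]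
      refine ⟨x, ?_⟩
      ext y
      simp only [mem_filter, mem_univ, true_and, mem_singleton]
      exact ⟨hu y, fun h => h ▸ hx⟩
    · rw [card_eq_zero, filter_eq_empty_iff]
      rintro x - ⟨hx, rfl⟩
      exact hv (h1 x hx)

lemma mem_cycleMatchings {S H : Finset (Fin 4)} :
    H ∈ cycleMatchings S ↔ (∀ e ∈ H, e ∈ S ∧ e + 1 ∈ S) ∧
      ∀ i ∈ S, ∃! e, e ∈ H ∧ (i = e ∨ i = e + 1) := by
  simp only [cycleMatchings, mem_filter, mem_univ, true_and]
  constructor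
  · intro h
    have key : ∀ e ∈ H, ∀ i, (i = e ∨ i = e + 1) → i ∈ S := by
      intro e he i hi
      by_contra hS
      have := h i
      rw [if_neg hS, card_eq_zero, filter_eq_empty_iff] at this
      exact this he hi
    refine ⟨fun e he => ⟨key e he e (.inl rfl), key e he _ (.inr rfl)⟩, fun i hi => ?_⟩
    have := h i
    rw [if_pos hi, card_eq_one] at this
    obtain ⟨e, he⟩ := this
    refine ⟨e, ?_, fun y hy => ?_⟩
    · have : e ∈ ({e} : Finset (Fin 4)) := mem_singleton_self e
      rw [← he] at this
      simpa using this
    · rw [← mem_singleton, ← he]; simpa using hy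
  · rintro ⟨h1, h2⟩ i
    split_ifs with hi
    · obtain ⟨e, he, hu⟩ := h2 i hi
      rw [card_eq_one]
      refine ⟨e, ?_⟩
      ext y
      simp only [mem_filter, mem_singleton]
      exact ⟨hu y, fun h => h ▸ he⟩
    · rw [card_eq_zero, filter_eq_empty_iff]
      rintro e he (rfl | rfl)
      · exact hi (h1 _ he).1
      · exact hi (h1 _ he).2

/-- The vertices of each 4-cycle that are covered by the chosen edges. -/
def coveredBy (H : ι → Finset (Fin 4)) (c : ι) : Finset (Fin 4) :=
  univ.filter fun i => ∃ e ∈ H c, i = e ∨ i = e + 1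

lemma eq_coveredBy {H A : ι → Finset (Fin 4)} (h : ∀ c, H c ∈ cycleMatchings (A c)) :
    A = coveredBy H := by
  ext c i
  obtain ⟨h1, h2⟩ := mem_cycleMatchings.1 (h c)
  simp only [coveredBy, mem_filter, mem_univ, true_and]
  constructor
  · intro hi
    obtain ⟨e, he, -⟩ := h2 i hi
    exact ⟨e, he⟩
  · rintro ⟨e, he, rfl | rfl⟩
    · exact (h1 _ he).1
    · exact (h1 _ he).2

/-- This separates the global condition (which cell covers which vertex) from the local ones (a
matching inside each cell). Injectivity ensures that a vertex has only one position within a cell.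
-/
lemma isCycleTiling_iff [Fintype ι] {nbr : ι × Fin 4 → W} (hnbr : ∀ c, Function.Injective fun i => nbr (c, i))
    {V : Finset W} {H : ι → Finset (Fin 4)} :
    IsCycleTiling nbr V H ↔
      IsExactCover nbr V (coveredBy H) ∧ ∀ c, H c ∈ cycleMatchings (coveredBy H c) := by
  have hcov : ∀ c i, i ∈ coveredBy H c ↔ ∃ e ∈ H c, i = e ∨ i = e + 1 := by simp [coveredBy]
  simp only [isExactCover_iff, mem_cycleMatchings]
  constructor
  · rintro ⟨h1, h2⟩
    have hV : ∀ x : ι × Fin 4, x.2 ∈ coveredBy H x.1 → nbr x ∈ V := by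
      rintro ⟨c, i⟩ hx
      obtain ⟨e, he, hi⟩ := (hcov _ _).1 hx
      exact h1 (c, e) he (mem_cycleEdge.2 ⟨i, hi, rfl⟩)
    refine ⟨⟨hV, fun v hv => ?_⟩, fun c => ⟨fun e he => ?_, fun i hi => ?_⟩⟩
    · obtain ⟨⟨c, e⟩, ⟨he, hve⟩, hu⟩ := h2 v hv
      obtain ⟨i, hi, hiv⟩ := mem_cycleEdge.1 hve
      refine ⟨(c, i), ⟨(hcov _ _).2 ⟨e, he, hi⟩, hiv⟩, ?_⟩
      rintro ⟨c', i'⟩ ⟨hx, hv'⟩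
      obtain ⟨e', he', hi'⟩ := (hcov _ _).1 hx
      have := hu (c', e') ⟨he', mem_cycleEdge.2 ⟨i', hi', hv'⟩⟩
      obtain ⟨rfl, rfl⟩ := Prod.mk.inj this
      rw [hnbr c' (hv'.trans hiv.symm)]
    · exact ⟨(hcov _ _).2 ⟨e, he, .inl rfl⟩, (hcov _ _).2 ⟨e, he, .inr rfl⟩⟩
    · obtain ⟨e, he, hie⟩ := (hcov _ _).1 hi
      refine ⟨e, ⟨he, hie⟩, fun e' ⟨he', hie'⟩ => ?_⟩
      have := (h2 _ (hV (c, i) hi)).unique (y₁ := (c, e')) (y₂ := (c, e))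
        ⟨he', mem_cycleEdge.2 ⟨i, hie', rfl⟩⟩ ⟨he, mem_cycleEdge.2 ⟨i, hie, rfl⟩⟩
      exact (Prod.mk.inj this).2
  · rintro ⟨⟨h1, h2⟩, h3⟩
    refine ⟨fun x hx v hv => ?_, fun v hv => ?_⟩
    · obtain ⟨i, hi, rfl⟩ := mem_cycleEdge.1 hv
      exact h1 (x.1, i) ((hcov _ _).2 ⟨x.2, hx, hi⟩)
    · obtain ⟨⟨c, i⟩, ⟨hi, hiv⟩, hu⟩ := h2 v hv
      obtain ⟨e, ⟨he, hie⟩, hue⟩ := (h3 c).2 i hi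
      refine ⟨(c, e), ⟨he, mem_cycleEdge.2 ⟨i, hie, hiv⟩⟩, ?_⟩
      rintro ⟨c', e'⟩ ⟨he', hv'⟩
      obtain ⟨i', hi', hiv'⟩ := mem_cycleEdge.1 hv'
      have := hu (c', i') ⟨(hcov _ _).2 ⟨e', he', hi'⟩, hiv'⟩
      obtain ⟨rfl, rfl⟩ := Prod.mk.inj this
      rw [hue e' ⟨he', hi'⟩]

/-- Tilings are sorted by the vertex sets that they cover in the cells. Once these are fixed, the
choices in different cells are independent, whence the product. -/
lemma card_isCycleTiling [Fintype ι] {nbr : ι × Fin 4 → W}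
    (hnbr : ∀ c, Function.Injective fun i => nbr (c, i)) (V : Finset W) :
    Nat.card {H // IsCycleTiling nbr V H} = matchingSum nbr V := by
  classical
  rw [Nat.card_eq_fintype_card, Fintype.card_subtype, matchingSum,
    card_eq_sum_card_fiberwise (f := coveredBy) (t := {A | IsExactCover nbr V A})]
  · refine sum_congr rfl fun A hA => ?_
    simp only [mem_filter, mem_univ, true_and] at hA
    rw [← Fintype.card_piFinset]
    congr 1
    ext H
    simp only [mem_filter, mem_univ, true_and, Fintype.mem_piFinset, isCycleTiling_iff hnbr]
    constructor
    · rintro ⟨⟨-, h⟩, rfl⟩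
      exact h
    · intro h
      obtain rfl := eq_coveredBy h
      exact ⟨⟨hA, h⟩, rfl⟩
  · intro H hH
    simp only [coe_filter, mem_univ, true_and, Set.mem_ofPred_eq] at hH ⊢
    exact ((isCycleTiling_iff hnbr).1 hH).1

end Complementation

/-! ### The 4-cycles of the chessboard, and complementation for regions. -/

/-- The vertices of the 4-cycle around the chessboard square `x.1`, in cyclic order. -/
def around (x : Cell × Fin 4) : Cell :=
  x.1 + (![(1, 0), (0, 1), (-1, 0), (0, -1)] : Fin 4 → ℤ × ℤ) x.2

lemma around_injective (c : Cell) : Function.Injective fun i => around (c, i) := by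
  intro i j h
  have h' : (![(1, 0), (0, 1), (-1, 0), (0, -1)] : Fin 4 → ℤ × ℤ) i =
      (![(1, 0), (0, 1), (-1, 0), (0, -1)] : Fin 4 → ℤ × ℤ) j := add_left_cancel h
  clear h
  revert i j
  decide

lemma adj_around (c : Cell) (i : Fin 4) : cornerGraph.Adj (around (c, i)) (around (c, i + 1)) := by
  obtain ⟨x, y⟩ := c
  fin_cases i <;> simp [around, cornerGraph]

lemma exists_around_eq {p q c : Cell} (h : cornerGraph.Adj p q)
    (hc : c = (p.1, q.2) ∨ c = (q.1, p.2)) :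
    ∃ i, ({around (c, i), around (c, i + 1)} : Finset Cell) = {p, q} := by
  obtain ⟨x, y⟩ := p
  obtain ⟨x', y'⟩ := q
  obtain ⟨h1, h2⟩ := h
  simp only at h1 h2 hc
  have h1' : x = x' + 1 ∨ x = x' - 1 := by
    rcases (abs_eq zero_le_one).1 h1 with h | h <;> omega
  have h2' : y = y' + 1 ∨ y = y' - 1 := by
    rcases (abs_eq zero_le_one).1 h2 with h | h <;> omega
  rcases hc with rfl | rfl <;> rcases h1' with rfl | rfl <;> rcases h2' with rfl | rfl <;>
  first
  | (refine ⟨0, ?_⟩; ext ⟨a, b⟩; simp [around, Prod.ext_iff] <;> grind)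
  | (refine ⟨1, ?_⟩; ext ⟨a, b⟩; simp [around, Prod.ext_iff] <;> grind)
  | (refine ⟨2, ?_⟩; ext ⟨a, b⟩; simp [around, Prod.ext_iff]; grind)
  | (refine ⟨3, ?_⟩; ext ⟨a, b⟩; simp [around, Prod.ext_iff]; grind)

/-- An edge lies in two 4-cycles, whose centres differ by one in both coordinates; equal parities
rule out one of them, so the cells are edge-disjoint. -/
lemma around_pair_injective {c c' : Cell} {i i' : Fin 4}
    (h1 : Even (c.1 - c'.1)) (h2 : Even (c.2 - c'.2))
    (h : ({around (c, i), around (c, i + 1)} : Finset Cell) =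
      {around (c', i'), around (c', i' + 1)}) : c = c' ∧ i = i' := by
  obtain ⟨x, y⟩ := c
  obtain ⟨x', y'⟩ := c'
  have h := congrArg (fun s : Finset Cell => (s : Set Cell)) h
  simp only [coe_insert, coe_singleton, Set.pair_eq_pair_iff] at h
  simp only [Int.even_iff] at h1 h2
  rw [Prod.mk.injEq]
  fin_cases i <;> fin_cases i' <;> simp [around, Prod.ext_iff] at h ⊢ <;> omega

/-- The complementation theorem: if all edges of two induced subgraphs lie in 4-cycles around the
squares in `C`, and every vertex lies in as many of these 4-cycles as of the two subgraphs, then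
the numbers of tilings are proportional. -/
theorem numTilings_compl (C V V' : Finset Cell)
    (hC : ∀ c ∈ C, ∀ c' ∈ C, Even (c.1 - c'.1) ∧ Even (c.2 - c'.2))
    (hdeg : ∀ x y : ℤ, (if (x + 1, y) ∈ C then 1 else 0) + (if (x - 1, y) ∈ C then 1 else 0) +
      (if (x, y + 1) ∈ C then 1 else 0) + (if (x, y - 1) ∈ C then 1 else 0) =
      (if (x, y) ∈ V then 1 else 0) + if (x, y) ∈ V' then 1 else 0)
    (hV : ∀ p ∈ V, ∀ q ∈ V, cornerGraph.Adj p q → (p.1, q.2) ∈ C ∨ (q.1, p.2) ∈ C)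
    (hV' : ∀ p ∈ V', ∀ q ∈ V', cornerGraph.Adj p q → (p.1, q.2) ∈ C ∨ (q.1, p.2) ∈ C) :
    (numTilings V' : ℝ) * √2 ^ #V = 2 ^ #C * numTilings V := by
  set nbr : C × Fin 4 → Cell := fun x => around (x.1, x.2) with hnbr
  have hinj : Function.Injective (cycleEdge nbr) := by
    rintro ⟨c, i⟩ ⟨c', i'⟩ h
    obtain ⟨h1, h2⟩ := hC c c.2 c' c'.2
    obtain ⟨h3, h4⟩ := around_pair_injective h1 h2 h
    exact Prod.ext (Subtype.ext h3) h4
  have hcount : ∀ U : Finset Cell,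
      (∀ p ∈ U, ∀ q ∈ U, cornerGraph.Adj p q → (p.1, q.2) ∈ C ∨ (q.1, p.2) ∈ C) →
      numTilings U = matchingSum nbr U := by
    intro U hU
    rw [← card_isCycleTiling (nbr := nbr) (fun c => around_injective c), numTilings]
    have hedge : ∀ p ∈ U, ∀ q ∈ U, cornerGraph.Adj p q → ∃ x, cycleEdge nbr x = {p, q} := by
      intro p hp q hq hpq
      rcases hU p hp q hq hpq with h | h
      · obtain ⟨i, hi⟩ := exists_around_eq hpq (.inl rfl)
        exact ⟨(⟨_, h⟩, i), hi⟩
      · obtain ⟨i, hi⟩ := exists_around_eq hpq (.inr rfl)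
        exact ⟨(⟨_, h⟩, i), hi⟩
    symm
    refine Nat.card_congr
      { toFun := fun H => ⟨(univ.filter fun x : C × Fin 4 => x.2 ∈ H.1 x.1).image (cycleEdge nbr),
          ?_, ?_⟩
        invFun := fun D => ⟨fun c => univ.filter fun i => cycleEdge nbr (c, i) ∈ D.1, ?_, ?_⟩
        left_inv := ?_
        right_inv := ?_ }
    · intro d hd
      simp only [mem_image, mem_filter, mem_univ, true_and] at hd
      obtain ⟨x, hx, rfl⟩ := hd
      have := H.2.1 x hx
      exact ⟨_, this (mem_insert_self _ _), _, this (mem_insert_of_mem (mem_singleton_self _)),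
        adj_around _ _, rfl⟩
    · intro p hp
      obtain ⟨x, ⟨hx, hpx⟩, hu⟩ := H.2.2 p hp
      refine ⟨cycleEdge nbr x, ⟨mem_image_of_mem _ (by simpa using hx), hpx⟩, ?_⟩
      rintro d ⟨hd, hpd⟩
      simp only [mem_image, mem_filter, mem_univ, true_and] at hd
      obtain ⟨y, hy, rfl⟩ := hd
      rw [hu y ⟨hy, hpd⟩]
    · intro x hx
      simp only [mem_filter, mem_univ, true_and] at hx
      obtain ⟨p, hp, q, hq, -, hd⟩ := D.2.1 _ hx
      rw [hd]
      intro v hv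
      simp only [mem_insert, mem_singleton] at hv
      rcases hv with rfl | rfl <;> assumption
    · intro v hv
      obtain ⟨d, ⟨hd, hvd⟩, hu⟩ := D.2.2 v hv
      obtain ⟨p, hp, q, hq, hpq, rfl⟩ := D.2.1 d hd
      obtain ⟨x, hx⟩ := hedge p hp q hq hpq
      refine ⟨x, ⟨by simpa [hx] using hd, hx ▸ hvd⟩, ?_⟩
      rintro y ⟨hy, hvy⟩
      exact hinj ((hu _ ⟨by simpa using hy, hvy⟩).trans hx.symm)
    · intro H
      ext c i
      simp [hinj.eq_iff]
    · intro D
      ext d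
      simp only [mem_image, mem_filter, mem_univ, true_and]
      constructor
      · rintro ⟨x, hx, rfl⟩
        exact hx
      · intro hd
        obtain ⟨p, hp, q, hq, hpq, rfl⟩ := D.2.1 d hd
        obtain ⟨x, hx⟩ := hedge p hp q hq hpq
        exact ⟨x, by simpa [hx] using hd, hx⟩
  rw [hcount V hV, hcount V' hV', ← Fintype.card_coe C]
  refine matchingSum_compl nbr V V' fun v => ?_
  obtain ⟨x, y⟩ := v
  rw [← hdeg x y]
  have hsum : #{z : C × Fin 4 | nbr z = (x, y)} =
      ∑ c ∈ C, ∑ i : Fin 4, if around (c, i) = (x, y) then 1 else 0 := by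
    rw [card_filter, ← univ_product_univ, sum_product, ← sum_coe_sort C]
  rw [hsum, sum_comm, Fin.sum_univ_four]
  have key : ∀ (i : Fin 4) (w : Cell), (∀ c, around (c, i) = (x, y) ↔ w = c) →
      (∑ c ∈ C, if around (c, i) = (x, y) then 1 else 0) = if w ∈ C then 1 else 0 := by
    intro i w h
    simp only [h, sum_ite_eq]
  -- The cycle in which `(x, y)` is vertex `0`, the eastern one, is centred one unit to its west;
  -- likewise for the other three directions.
  rw [key 0 (x - 1, y), key 1 (x, y - 1), key 2 (x + 1, y), key 3 (x, y + 1)]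
  · ring
  all_goals
    rintro ⟨a, b⟩
    simp [around]
    omega

/-! ### Tilings and perfect matchings. -/

/-- Tilings of a region are the perfect matchings of its dual graph. -/
theorem numPerfectMatchings_induce (R : Finset Cell) :
    numPerfectMatchings (cornerGraph.induce (R : Set Cell)) = numTilings R := by
  have hpair : ∀ p q r t : Cell, ({p, q} : Finset Cell) = {r, t} ↔
      p = r ∧ q = t ∨ p = t ∧ q = r := by
    intro p q r t
    rw [← coe_inj]
    simp only [coe_insert, coe_singleton, Set.pair_eq_pair_iff]
  classical
  refine Nat.card_congr
    { toFun := fun M => ⟨R.powerset.filter fun d => ∃ p q, M.1.Adj p q ∧ d = {p.1, q.1}, ?_, ?_⟩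
      invFun := fun D => ⟨
        { verts := Set.univ
          Adj := fun p q => cornerGraph.Adj p.1 q.1 ∧ ({p.1, q.1} : Finset Cell) ∈ D.1
          adj_sub := fun h => h.1
          edge_vert := fun _ => Set.mem_univ _
          symm := ⟨fun p q h => ⟨h.1.symm, by rw [pair_comm]; exact h.2⟩⟩ }, ?_⟩
      left_inv := ?_
      right_inv := ?_ }
  · intro d hd
    obtain ⟨-, p, q, h, rfl⟩ := mem_filter.1 hd
    exact ⟨p, p.2, q, q.2, M.1.adj_sub h, rfl⟩
  · intro v hv
    have hM := SimpleGraph.Subgraph.isPerfectMatching_iff.1 M.2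
    obtain ⟨w, hw, hu⟩ := hM ⟨v, hv⟩
    refine ⟨{v, w.1}, ⟨mem_filter.2 ⟨?_, _, _, hw, rfl⟩, mem_insert_self _ _⟩, ?_⟩
    · rw [mem_powerset]
      intro u hu
      simp only [mem_insert, mem_singleton] at hu
      rcases hu with rfl | rfl
      exacts [hv, w.2]
    · rintro d ⟨hd, hvd⟩
      obtain ⟨-, p, q, h, rfl⟩ := mem_filter.1 hd
      simp only [mem_insert, mem_singleton] at hvd
      rcases hvd with rfl | rfl
      · rw [hu q h]
      · rw [hu p h.symm, pair_comm]
  · rw [SimpleGraph.Subgraph.isPerfectMatching_iff]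
    intro v
    obtain ⟨d, ⟨hd, hvd⟩, hu⟩ := D.2.2 v.1 v.2
    obtain ⟨p, hp, q, hq, hpq, rfl⟩ := D.2.1 d hd
    simp only [mem_insert, mem_singleton] at hvd
    rcases hvd with h | h
    · refine ⟨⟨q, hq⟩, ⟨h ▸ hpq, h ▸ hd⟩, fun w hw => ?_⟩
      have := hu _ ⟨hw.2, mem_insert_self _ _⟩
      rw [h, hpair] at this
      have hne := hpq.ne
      exact Subtype.ext (by grind)
    · refine ⟨⟨p, hp⟩, ⟨h ▸ hpq.symm, by rw [pair_comm]; exact h ▸ hd⟩, fun w hw => ?_⟩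
      have := hu _ ⟨hw.2, mem_insert_self _ _⟩
      rw [h, hpair] at this
      have hne := hpq.ne
      exact Subtype.ext (by grind)
  · intro M
    refine Subtype.ext (SimpleGraph.Subgraph.ext ?_ ?_)
    · exact (SimpleGraph.Subgraph.isSpanning_iff.1 M.2.2).symm
    · ext p q
      simp only [mem_filter]
      constructor
      · rintro ⟨-, -, p', q', h, he⟩
        rw [hpair] at he
        rcases he with ⟨h1, h2⟩ | ⟨h1, h2⟩
        · rwa [Subtype.ext h1, Subtype.ext h2]
        · rw [Subtype.ext h1, Subtype.ext h2]; exact h.symm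
      · intro h
        refine ⟨M.1.adj_sub h, ?_, p, q, h, rfl⟩
        rw [mem_powerset]
        intro u hu
        simp only [mem_insert, mem_singleton] at hu
        rcases hu with rfl | rfl
        exacts [p.2, q.2]
  · intro D
    ext d
    simp only [mem_filter, mem_powerset]
    constructor
    · rintro ⟨-, p, q, ⟨-, h⟩, rfl⟩
      exact h
    · intro hd
      obtain ⟨p, hp, q, hq, hpq, rfl⟩ := D.2.1 d hd
      refine ⟨?_, ⟨p, hp⟩, ⟨q, hq⟩, ⟨hpq, hd⟩, rfl⟩
      intro u hu
      simp only [mem_insert, mem_singleton] at hu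
      rcases hu with rfl | rfl <;> assumption

/-! ### Coordinates and cardinalities of Aztec rectangles. -/

/-- The arithmetic progression `l, l + 2, …` with `t` terms. -/
def stepTwo (l : ℤ) (t : ℕ) : Finset ℤ :=
  (range t).image fun i : ℕ => l + 2 * i

lemma mem_stepTwo {l x : ℤ} {t : ℕ} : x ∈ stepTwo l t ↔ l ≤ x ∧ x < l + 2 * t ∧ (x - l) % 2 = 0 := by
  simp only [stepTwo, mem_image, mem_range]
  constructor
  · rintro ⟨i, hi, rfl⟩
    omega
  · rintro ⟨h1, h2, h3⟩
    exact ⟨((x - l) / 2).toNat, by omega, by omega⟩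

lemma card_stepTwo (l : ℤ) (t : ℕ) : #(stepTwo l t) = t := by
  rw [stepTwo, card_image_of_injective _ (fun i j h => by simpa using h), card_range]

lemma mem_aztecRect {z : Cell} {m n : ℕ} {x y : ℤ} :
    (x, y) ∈ aztecRect z m n ↔ (z.1 - n ≤ x ∧ x ≤ z.1 + n) ∧ (z.2 - m ≤ y ∧ y ≤ z.2 + m) ∧
      (x - z.1 + n + (y - z.2 + m)) % 2 = 1 := by
  simp only [aztecRect, board, mem_filter, mem_product, mem_Icc, Int.odd_iff]
  rw [and_assoc, show x - (z.1 - n) + (y - (z.2 - m)) = x - z.1 + n + (y - z.2 + m) by ring]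

lemma mem_oddAztecRect {z : Cell} {m n : ℕ} {x y : ℤ} :
    (x, y) ∈ oddAztecRect z m n ↔ (z.1 - n ≤ x ∧ x ≤ z.1 + n) ∧ (z.2 - m ≤ y ∧ y ≤ z.2 + m) ∧
      (x - z.1 + n + (y - z.2 + m)) % 2 = 0 := by
  simp only [oddAztecRect, board, mem_filter, mem_product, mem_Icc, Int.even_iff]
  rw [and_assoc, show x - (z.1 - n) + (y - (z.2 - m)) = x - z.1 + n + (y - z.2 + m) by ring]

lemma card_aztecRect (z : Cell) (m n : ℕ) : #(aztecRect z m n) = (n + 1) * m + n * (m + 1) := by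
  have h : aztecRect z m n = (stepTwo (z.1 - n) (n + 1) ×ˢ stepTwo (z.2 - m + 1) m) ∪
      (stepTwo (z.1 - n + 1) n ×ˢ stepTwo (z.2 - m) (m + 1)) := by
    ext ⟨x, y⟩
    simp only [mem_aztecRect, mem_union, mem_product, mem_stepTwo]
    omega
  rw [h, card_union_of_disjoint]
  · simp only [card_product, card_stepTwo]
  · rw [disjoint_left]
    rintro ⟨x, y⟩
    simp only [mem_product, mem_stepTwo]
    omega

lemma card_oddAztecRect (z : Cell) (m n : ℕ) :
    #(oddAztecRect z m n) = (n + 1) * (m + 1) + n * m := by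
  have h : oddAztecRect z m n = (stepTwo (z.1 - n) (n + 1) ×ˢ stepTwo (z.2 - m) (m + 1)) ∪
      (stepTwo (z.1 - n + 1) n ×ˢ stepTwo (z.2 - m + 1) m) := by
    ext ⟨x, y⟩
    simp only [mem_oddAztecRect, mem_union, mem_product, mem_stepTwo]
    omega
  rw [h, card_union_of_disjoint]
  · simp only [card_product, card_stepTwo]
  · rw [disjoint_left]
    rintro ⟨x, y⟩
    simp only [mem_product, mem_stepTwo]
    omega

lemma card_sdiff_biUnion {α ι : Type*} [DecidableEq α] [Fintype ι] (U : Finset α)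
    (B : ι → Finset α) (hU : ∀ i, B i ⊆ U) (hB : ∀ i j, i ≠ j → Disjoint (B i) (B j)) :
    #(U \ univ.biUnion B) + ∑ i, #(B i) = #U := by
  rw [← card_biUnion (fun i _ j _ h => hB i j h), card_sdiff_add_card_eq_card]
  exact biUnion_subset.2 fun i _ => hU i

/-! ### Frames with windows, and the cells that link consecutive orders. -/

/-- The columns `X i` are possible centres of disjoint windows of width `a i` in the frame of
height `m` and width `n`. -/
structure IsWindowFamily (m n : ℕ) {s : ℕ} (a : Fin s → ℕ) (X : Fin s → ℤ) : Prop where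
  height_even : m % 2 = 0
  parity : ∀ i, (X i - a i + n) % 2 = 0
  left_le : ∀ i, -(n : ℤ) ≤ X i - a i
  le_right : ∀ i, X i + a i ≤ n
  gap : ∀ i j, i ≠ j → X i + a i + 2 ≤ X j - a j ∨ X j + a j + 2 ≤ X i - a i

/-- The square `(x, y)` lies in the bounding box of the window of height `j` in column `X`. -/
def InWindow (j : ℕ) (a : ℕ) (X x y : ℤ) : Prop :=
  (X - a + j ≤ x ∧ x ≤ X + a - j) ∧ -1 - (j : ℤ) ≤ y ∧ y ≤ -1 + j

section

variable {m n s : ℕ} {a : Fin s → ℕ} {X : Fin s → ℤ}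

/-- The frame of order `j` with windows of height `j` in the columns `X i`. -/
noncomputable def holeyRect (m n j : ℕ) {s : ℕ} (a : Fin s → ℕ) (X : Fin s → ℤ) : Finset Cell :=
  aztecRect (0, 0) (m - j) (n - j) \
    univ.biUnion fun i => oddAztecRect (X i, -1) j (a i - j)

/-- The centres of the 4-cycles that make up the graph on `holeyRect m n j a X`. -/
def holeyCells (m n j : ℕ) {s : ℕ} (a : Fin s → ℕ) (X : Fin s → ℤ) : Finset Cell :=
  (stepTwo (-n + j + 1) (n - j) ×ˢ stepTwo (-m + j + 1) (m - j)) \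
    univ.biUnion fun i => stepTwo (X i - a i + j + 1) (a i - j) ×ˢ stepTwo (-1 - j) (j + 1)

lemma mem_holeyRect (h : IsWindowFamily m n a X) {j : ℕ} (hjm : j ≤ m) (hjn : j ≤ n)
    (hja : ∀ i, j ≤ a i) {x y : ℤ} :
    (x, y) ∈ holeyRect m n j a X ↔ (-(n : ℤ) + j ≤ x ∧ x ≤ n - j) ∧
      (-(m : ℤ) + j ≤ y ∧ y ≤ m - j) ∧ (x + y + n) % 2 = 1 ∧
      ∀ i, ¬ InWindow j (a i) (X i) x y := by
  have hm := h.height_even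
  simp only [holeyRect, mem_sdiff, mem_aztecRect, mem_biUnion, mem_univ, true_and, not_exists,
    mem_oddAztecRect, InWindow]
  constructor
  · rintro ⟨h1, h2⟩
    refine ⟨by omega, by omega, by omega, fun i => ?_⟩
    have := h2 i
    have := h.parity i
    have := hja i
    omega
  · rintro ⟨h1, h2, h3, h4⟩
    refine ⟨by omega, fun i => ?_⟩
    have := h4 i
    have := hja i
    omega

lemma mem_holeyCells (h : IsWindowFamily m n a X) {j : ℕ} (hjm : j ≤ m) (hjn : j ≤ n)
    (hja : ∀ i, j ≤ a i) {x y : ℤ} :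
    (x, y) ∈ holeyCells m n j a X ↔ (-(n : ℤ) + j < x ∧ x < n - j) ∧
      (-(m : ℤ) + j < y ∧ y < m - j) ∧ (x + n + j) % 2 = 1 ∧ (y + j) % 2 = 1 ∧
      ∀ i, ¬ InWindow j (a i) (X i) x y := by
  have hm := h.height_even
  simp only [holeyCells, mem_sdiff, mem_product, mem_stepTwo, mem_biUnion, mem_univ, true_and,
    not_exists, InWindow]
  constructor
  · rintro ⟨h1, h2⟩
    refine ⟨by omega, by omega, by omega, by omega, fun i => ?_⟩
    have := h2 i
    have := h.parity i
    have := hja i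
    omega
  · rintro ⟨h1, h2, h3, h4, h5⟩
    refine ⟨by omega, fun i => ?_⟩
    have := h5 i
    have := hja i
    omega

lemma card_holeyRect (h : IsWindowFamily m n a X) {j : ℕ} (hjm : 2 * j < m) (hjn : j ≤ n)
    (hja : ∀ i, j ≤ a i) :
    #(holeyRect m n j a X) + ∑ i, ((a i - j + 1) * (j + 1) + (a i - j) * j) =
      (n - j + 1) * (m - j) + (n - j) * (m - j + 1) := by
  have hm := h.height_even
  rw [← card_aztecRect (0, 0) (m - j) (n - j), holeyRect,
    sum_congr rfl fun i _ => (card_oddAztecRect (X i, -1) j (a i - j)).symm]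
  apply card_sdiff_biUnion
  · rintro i ⟨x, y⟩
    have := h.parity i
    have := h.left_le i
    have := h.le_right i
    have := hja i
    simp only [mem_oddAztecRect, mem_aztecRect]
    omega
  · intro i i' hi
    rw [disjoint_left]
    rintro ⟨x, y⟩
    have := h.gap i i' hi
    have := hja i
    have := hja i'
    simp only [mem_oddAztecRect]
    omega

lemma card_holeyCells (h : IsWindowFamily m n a X) {j : ℕ} (hjm : 2 * j + 1 < m) (hjn : j ≤ n)
    (hja : ∀ i, j ≤ a i) :
    #(holeyCells m n j a X) + ∑ i, (a i - j) * (j + 1) = (n - j) * (m - j) := by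
  have hm := h.height_even
  have h1 : #(stepTwo (-n + j + 1) (n - j) ×ˢ stepTwo (-m + j + 1) (m - j)) =
      (n - j) * (m - j) := by
    simp only [card_product, card_stepTwo]
  have h2 : ∀ i, #(stepTwo (X i - a i + j + 1) (a i - j) ×ˢ stepTwo (-1 - j) (j + 1)) =
      (a i - j) * (j + 1) := by
    intro i
    simp only [card_product, card_stepTwo]
  rw [← h1, holeyCells]
  simp only [← h2]
  apply card_sdiff_biUnion
  · rintro i ⟨x, y⟩
    have := h.parity i
    have := h.left_le i
    have := h.le_right i
    have := hja i
    simp only [mem_product, mem_stepTwo]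
    omega
  · intro i i' hi
    rw [disjoint_left]
    rintro ⟨x, y⟩
    have := h.gap i i' hi
    have := hja i
    have := hja i'
    simp only [mem_product, mem_stepTwo]
    omega

lemma holeyCells_parity (h : IsWindowFamily m n a X) {j : ℕ} (hjm : j ≤ m) (hjn : j ≤ n)
    (hja : ∀ i, j ≤ a i) :
    ∀ c ∈ holeyCells m n j a X, ∀ c' ∈ holeyCells m n j a X,
      Even (c.1 - c'.1) ∧ Even (c.2 - c'.2) := by
  rintro ⟨x, y⟩ hc ⟨x', y'⟩ hc'
  rw [mem_holeyCells h hjm hjn hja] at hc hc'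
  simp only [Int.even_iff]
  omega

/-- Exactly one of the two candidate centres has the parity of the cells. The end columns of a
window have the wrong parity, so a centre in a window box lies strictly between them; the endpoint
of the edge in the same row would then be in the box too. -/
lemma corner_mem_holeyCells (h : IsWindowFamily m n a X) {j : ℕ} (hjm : j < m) (hjn : j < n)
    (hja : ∀ i, j < a i) :
    ∀ p ∈ holeyRect m n j a X, ∀ q ∈ holeyRect m n j a X, cornerGraph.Adj p q →
      (p.1, q.2) ∈ holeyCells m n j a X ∨ (q.1, p.2) ∈ holeyCells m n j a X := by
  rintro ⟨x, y⟩ hp ⟨x', y'⟩ hq ⟨h1, h2⟩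
  rw [mem_holeyRect h hjm.le hjn.le fun i => (hja i).le] at hp hq
  rw [abs_eq zero_le_one] at h1 h2
  simp only [mem_holeyCells h hjm.le hjn.le fun i => (hja i).le]
  simp only [InWindow] at *
  have hm := h.height_even
  obtain ⟨p1, p2, p3, p4⟩ := hp
  obtain ⟨q1, q2, q3, q4⟩ := hq
  rcases Int.emod_two_eq_zero_or_one (x + n + j) with hx | hx
  · right
    refine ⟨by omega, by omega, by omega, by omega, fun i => ?_⟩
    have := p4 i
    have := h.parity i
    omega
  · left
    refine ⟨by omega, by omega, by omega, by omega, fun i => ?_⟩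
    have := q4 i
    have := h.parity i
    omega

/-- Here the endpoint in the same column as the centre gives the contradiction: it would lie in the
box of order `j + 1`, which is narrower but one row taller at top and bottom. -/
lemma corner_mem_holeyCells_of_succ (h : IsWindowFamily m n a X) {j : ℕ} (hjm : j < m)
    (hjn : j < n) (hja : ∀ i, j < a i) :
    ∀ p ∈ holeyRect m n (j + 1) a X, ∀ q ∈ holeyRect m n (j + 1) a X, cornerGraph.Adj p q →
      (p.1, q.2) ∈ holeyCells m n j a X ∨ (q.1, p.2) ∈ holeyCells m n j a X := by
  rintro ⟨x, y⟩ hp ⟨x', y'⟩ hq ⟨h1, h2⟩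
  rw [mem_holeyRect h hjm hjn hja] at hp hq
  rw [abs_eq zero_le_one] at h1 h2
  simp only [mem_holeyCells h hjm.le hjn.le fun i => (hja i).le]
  simp only [InWindow] at *
  have hm := h.height_even
  obtain ⟨p1, p2, p3, p4⟩ := hp
  obtain ⟨q1, q2, q3, q4⟩ := hq
  push_cast at *
  rcases Int.emod_two_eq_zero_or_one (x + n + j) with hx | hx
  · right
    refine ⟨by omega, by omega, by omega, by omega, fun i => ?_⟩
    have := q4 i
    have := h.parity i
    omega
  · left
    refine ⟨by omega, by omega, by omega, by omega, fun i => ?_⟩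
    have := p4 i
    have := h.parity i
    omega

/-- Only one window is relevant in and next to a given column. -/
lemma forall_not_inWindow_iff (h : IsWindowFamily m n a X) {j j' : ℕ} {i : Fin s} {x x' y : ℤ}
    (hx : X i - a i + j ≤ x ∧ x ≤ X i + a i - j) (hx' : x - 1 ≤ x' ∧ x' ≤ x + 1) :
    (∀ i', ¬ InWindow j' (a i') (X i') x' y) ↔ ¬ InWindow j' (a i) (X i) x' y := by
  refine ⟨fun H => H i, fun H i' => ?_⟩
  rcases eq_or_ne i' i with rfl | hi
  · exact H
  · have := h.gap i' i hi
    simp only [InWindow]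
    omega

/-- Degree count along a line of alternating vertices and cells: `P` and `Q` say that the next and
the previous cell exist. End vertices touch one cell and survive only in the closed interval (order
`j`); inner vertices touch two and lie in both regions. -/
lemma ite_add_ite_of_interval {P Q P' Q' R : Prop} [Decidable P] [Decidable Q] [Decidable P']
    [Decidable Q'] {l r x : ℤ} (hlr : l < r) (hP : P ↔ R ∧ l ≤ x ∧ x < r)
    (hQ : Q ↔ R ∧ l < x ∧ x ≤ r) (hP' : P' ↔ R ∧ l ≤ x ∧ x ≤ r) (hQ' : Q' ↔ R ∧ l < x ∧ x < r) :
    (if P then 1 else 0) + (if Q then 1 else 0) =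
      (if P' then 1 else 0) + if Q' then 1 else 0 := by
  by_cases hR : R
  · simp only [hR, true_and] at hP hQ hP' hQ'
    simp only [hP, hQ, hP', hQ']
    split_ifs <;> omega
  · simp only [hR, false_and, iff_false] at hP hQ hP' hQ'
    simp [hP, hQ, hP', hQ']

lemma holeyCells_degree_of_mem (h : IsWindowFamily m n a X) {j : ℕ} (hjm : 2 * j + 2 < m)
    (hjn : j < n) (hja : ∀ i, j < a i) {x y : ℤ} (hxy : (x + y + n) % 2 = 1) {i : Fin s}
    (hi : X i - a i + j ≤ x ∧ x ≤ X i + a i - j) :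
    (if (x + 1, y) ∈ holeyCells m n j a X then 1 else 0) +
      (if (x - 1, y) ∈ holeyCells m n j a X then 1 else 0) +
      (if (x, y + 1) ∈ holeyCells m n j a X then 1 else 0) +
      (if (x, y - 1) ∈ holeyCells m n j a X then 1 else 0) =
    (if (x, y) ∈ holeyRect m n j a X then 1 else 0) +
      if (x, y) ∈ holeyRect m n (j + 1) a X then 1 else 0 := by
  have hjm' : j < m := by omega
  have hm := h.height_even
  have hja' : ∀ i, j ≤ a i := fun i => (hja i).le
  have mC := fun u v => mem_holeyCells h hjm'.le hjn.le hja' (x := u) (y := v)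
  have mV := mem_holeyRect h hjm'.le hjn.le hja' (x := x) (y := y)
  have mV' := mem_holeyRect h hjm' hjn hja (x := x) (y := y)
  have e₁ := mC (x + 1) y
  have e₂ := mC (x - 1) y
  have e₃ := mC x (y + 1)
  have e₄ := mC x (y - 1)
  have key : ∀ {P Q : Prop}, (P ↔ Q) → ¬ Q → ¬ P := fun h h' => mt h.1 h'
  have hpar := h.parity i
  have hleft := h.left_le i
  have hright := h.le_right i
  have hai := hja i
  rw [forall_not_inWindow_iff h hi (by omega)] at e₁ e₂ e₃ e₄ mV
  rw [forall_not_inWindow_iff h hi (by omega)] at mV'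
  simp only [InWindow] at e₁ e₂ e₃ e₄ mV mV'
  clear mC hja' hja
  generalize a i = a' at *
  generalize X i = X' at *
  push_cast at mV'
  rcases Int.emod_two_eq_zero_or_one (x + n + j) with hx | hx
  · rw [if_neg (key e₃ (by omega)), if_neg (key e₄ (by omega)), add_zero, add_zero]
    -- Cells can only be to the left and right. Beside the box, a vertex in an end column of the
    -- window touches the one cell outside and belongs to order `j + 1` only: the window gets
    -- narrower.
    by_cases hW : -1 - (j : ℤ) ≤ y ∧ y ≤ -1 + j
    · rw [if_neg (key mV (by omega)), zero_add]
      by_cases hxr : x = X' + a' - j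
      · rw [if_neg (key e₂ (by omega)), add_zero]
        have : (x + 1, y) ∈ holeyCells m n j a X ↔ (x, y) ∈ holeyRect m n (j + 1) a X := by
          rw [e₁, mV']; omega
        simp only [this]
      · rw [if_neg (key e₁ (by omega)), zero_add]
        by_cases hxl : x = X' - a' + j
        · have : (x - 1, y) ∈ holeyCells m n j a X ↔ (x, y) ∈ holeyRect m n (j + 1) a X := by
            rw [e₂, mV']; omega
          simp only [this]
        · rw [if_neg (key e₂ (by omega)), if_neg (key mV' (by omega))]
    · exact ite_add_ite_of_interval (R := -(m : ℤ) + j < y ∧ y < m - j) (l := -n + j)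
        (r := n - j) (x := x) (by omega) (e₁.trans (by omega)) (e₂.trans (by omega))
        (mV.trans (by omega)) (mV'.trans (by omega))
  · rw [if_neg (key e₁ (by omega)), if_neg (key e₂ (by omega)), add_zero, zero_add]
    -- Cells can only be above and below, and the window cuts the column into two intervals. Their
    -- ends next to the window, rows `-2 - j` and `j`, belong to order `j` only: the window gets
    -- taller.
    rcases le_or_gt y (-2) with hy | hy
    · exact ite_add_ite_of_interval (R := -(n : ℤ) + j < x ∧ x < n - j) (l := -m + j)
        (r := -2 - j) (x := y) (by omega) (e₃.trans (by omega)) (e₄.trans (by omega)) (mV.trans (by omega)) (mV'.trans (by omega))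
    · exact ite_add_ite_of_interval (R := -(n : ℤ) + j < x ∧ x < n - j) (l := j)
        (r := m - j) (x := y) (by omega) (e₃.trans (by omega)) (e₄.trans (by omega)) (mV.trans (by omega)) (mV'.trans (by omega))

lemma holeyCells_degree_of_notMem (h : IsWindowFamily m n a X) {j : ℕ} (hjm : 2 * j + 2 < m)
    (hjn : j < n) (hja : ∀ i, j < a i) {x y : ℤ} (hxy : (x + y + n) % 2 = 1)
    (hcol : ∀ i, X i - a i + j ≤ x → X i + a i - j < x) :
    (if (x + 1, y) ∈ holeyCells m n j a X then 1 else 0) +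
      (if (x - 1, y) ∈ holeyCells m n j a X then 1 else 0) +
      (if (x, y + 1) ∈ holeyCells m n j a X then 1 else 0) +
      (if (x, y - 1) ∈ holeyCells m n j a X then 1 else 0) =
    (if (x, y) ∈ holeyRect m n j a X then 1 else 0) +
      if (x, y) ∈ holeyRect m n (j + 1) a X then 1 else 0 := by
  have hjm' : j < m := by omega
  have hm := h.height_even
  have hja' : ∀ i, j ≤ a i := fun i => (hja i).le
  have mC := fun u v => mem_holeyCells h hjm'.le hjn.le hja' (x := u) (y := v)
  have mV := mem_holeyRect h hjm'.le hjn.le hja' (x := x) (y := y)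
  have mV' := mem_holeyRect h hjm' hjn hja (x := x) (y := y)
  have e₁ := mC (x + 1) y
  have e₂ := mC (x - 1) y
  have e₃ := mC x (y + 1)
  have e₄ := mC x (y - 1)
  have key : ∀ {P Q : Prop}, (P ↔ Q) → ¬ Q → ¬ P := fun h h' => mt h.1 h'
  -- A neighbouring column could meet a window only in an end column, which has the wrong parity for
  -- cells.
  have hwin : ∀ {j' x' y'}, j ≤ j' → (x' = x ∨ (x' = x + 1 ∨ x' = x - 1) ∧ (x' + n + j) % 2 = 1) →
      ∀ i, ¬ InWindow j' (a i) (X i) x' y' := by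
    intro j' x' y' hj hx' i
    have := hcol i
    have := h.parity i
    have := hja i
    simp only [InWindow]
    omega
  have f₃ : ∀ y', ∀ i, ¬ InWindow j (a i) (X i) x y' := fun y' => hwin le_rfl (.inl rfl)
  have f₄ : ∀ i, ¬ InWindow (j + 1) (a i) (X i) x y := hwin (Nat.le_succ j) (.inl rfl)
  rcases Int.emod_two_eq_zero_or_one (x + n + j) with hx | hx
  · have f₁ : ∀ i, ¬ InWindow j (a i) (X i) (x + 1) y := hwin le_rfl (.inr ⟨.inl rfl, by omega⟩)
    have f₂ : ∀ i, ¬ InWindow j (a i) (X i) (x - 1) y := hwin le_rfl (.inr ⟨.inr rfl, by omega⟩)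
    simp only [f₁, f₂, f₃, f₄, not_false_eq_true, implies_true, and_true] at e₁ e₂ e₃ e₄ mV mV'
    rw [if_neg (key e₃ (by omega)), if_neg (key e₄ (by omega)), add_zero, add_zero]
    exact ite_add_ite_of_interval (R := -(m : ℤ) + j < y ∧ y < m - j) (l := -n + j)
        (r := n - j) (x := x) (by omega) (e₁.trans (by omega)) (e₂.trans (by omega))
        (mV.trans (by omega)) (mV'.trans (by omega))
  · simp only [f₃, f₄, not_false_eq_true, implies_true, and_true] at e₃ e₄ mV mV'
    rw [if_neg (key e₁ (by omega)), if_neg (key e₂ (by omega)), add_zero, zero_add]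
    exact ite_add_ite_of_interval (R := -(n : ℤ) + j < x ∧ x < n - j) (l := -m + j)
        (r := m - j) (x := y) (by omega) (e₃.trans (by omega)) (e₄.trans (by omega))
        (mV.trans (by omega)) (mV'.trans (by omega))

lemma holeyCells_degree (h : IsWindowFamily m n a X) {j : ℕ} (hjm : 2 * j + 2 < m) (hjn : j < n)
    (hja : ∀ i, j < a i) (x y : ℤ) :
    (if (x + 1, y) ∈ holeyCells m n j a X then 1 else 0) +
      (if (x - 1, y) ∈ holeyCells m n j a X then 1 else 0) +
      (if (x, y + 1) ∈ holeyCells m n j a X then 1 else 0) +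
      (if (x, y - 1) ∈ holeyCells m n j a X then 1 else 0) =
    (if (x, y) ∈ holeyRect m n j a X then 1 else 0) +
      if (x, y) ∈ holeyRect m n (j + 1) a X then 1 else 0 := by
  rcases Int.emod_two_eq_zero_or_one (x + y + n) with hxy | hxy
  · have hja' : ∀ i, j ≤ a i := fun i => (hja i).le
    have hjm' : j < m := by omega
    have hm := h.height_even
    have mC : ∀ u v, (u + v) % 2 ≠ (n : ℤ) % 2 → (u, v) ∉ holeyCells m n j a X := by
      intro u v huv
      rw [mem_holeyCells h hjm'.le hjn.le hja']
      omega
    rw [if_neg (mC _ _ (by omega)), if_neg (mC _ _ (by omega)), if_neg (mC _ _ (by omega)),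
      if_neg (mC _ _ (by omega)), if_neg, if_neg]
    · rw [mem_holeyRect h hjm' hjn hja]; omega
    · rw [mem_holeyRect h hjm'.le hjn.le hja']; omega
  · by_cases hcol : ∃ i, X i - a i + j ≤ x ∧ x ≤ X i + a i - j
    · obtain ⟨i, hi⟩ := hcol
      exact holeyCells_degree_of_mem h hjm hjn hja hxy hi
    · push Not at hcol
      exact holeyCells_degree_of_notMem h hjm hjn hja hxy hcol

end

/-! ### The exponent of a single step, and the induction. -/

lemma two_mul_card_holeyCells {m n s : ℕ} {a : Fin s → ℕ} {X : Fin s → ℤ}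
    (h : IsWindowFamily m n a X) (hmn : m = n + ∑ i, (a i + 1)) {j : ℕ} (hjm : 2 * j + 1 < m)
    (hjn : j ≤ n) (hja : ∀ i, j ≤ a i) :
    2 * (#(holeyCells m n j a X) : ℤ) = #(holeyRect m n j a X) + 2 * (j + s * (j + 1) - m) := by
  have h1 := card_holeyRect h (by omega) hjn hja
  have h2 := card_holeyCells h hjm hjn hja
  -- Each window has `2 * j + 1 - a i` more vertices than twice its cells, and the full frame has `m
  -- + n - 2 * j` more. By `hmn`, the terms `a i` combine with `n` to `m - s`.
  have h3 : ∑ i, ((a i - j + 1) * (j + 1) + (a i - j) * j) + ∑ i, a i =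
      2 * ∑ i, (a i - j) * (j + 1) + s * (2 * j + 1) := by
    have hs : s * (2 * j + 1) = ∑ _i : Fin s, (2 * j + 1) := by simp
    rw [hs, mul_sum, ← sum_add_distrib, ← sum_add_distrib]
    refine sum_congr rfl fun i _ => ?_
    obtain ⟨b, hb⟩ := Nat.exists_eq_add_of_le (hja i)
    rw [hb, Nat.add_sub_cancel_left]
    ring
  have h4 : ∑ i, (a i + 1) = ∑ i, a i + s := by simp [sum_add_distrib]
  rw [h4] at hmn
  obtain ⟨p, hp⟩ := Nat.exists_eq_add_of_le hjn
  obtain ⟨q, hq⟩ := Nat.exists_eq_add_of_le (show j ≤ m by omega)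
  rw [show n - j = p by omega, show m - j = q by omega] at h1 h2
  generalize ∑ i, ((a i - j + 1) * (j + 1) + (a i - j) * j) = S at *
  generalize ∑ i, (a i - j) * (j + 1) = S' at *
  generalize ∑ i, a i = A at *
  zify at *
  linarith

/-- One step of the complementation. -/
lemma numTilings_holeyRect_succ {m n s : ℕ} {a : Fin s → ℕ} {X : Fin s → ℤ}
    (h : IsWindowFamily m n a X) (hmn : m = n + ∑ i, (a i + 1)) {j : ℕ} (hjm : 2 * j + 2 < m)
    (hjn : j < n) (hja : ∀ i, j < a i) :
    (numTilings (holeyRect m n (j + 1) a X) : ℚ) =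
      2 ^ ((j : ℤ) + s * (j + 1) - m) * numTilings (holeyRect m n j a X) := by
  have hja' : ∀ i, j ≤ a i := fun i => (hja i).le
  have hcard := two_mul_card_holeyCells h hmn (by omega) hjn.le hja'
  have hcompl := numTilings_compl _ _ _ (holeyCells_parity h (by omega) hjn.le hja')
    (holeyCells_degree h hjm hjn hja) (corner_mem_holeyCells h (by omega) hjn hja)
    (corner_mem_holeyCells_of_succ h (by omega) hjn hja)
  generalize (j : ℤ) + s * (j + 1) - m = e at *
  -- `hcard` forces the number of vertices to be even, so the power of `√2` is an integral power of
  -- `2`.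
  obtain ⟨v, hv⟩ : ∃ v, #(holeyRect m n j a X) = 2 * v :=
    ⟨#(holeyRect m n j a X) / 2, by omega⟩
  rw [hv, pow_mul, Real.sq_sqrt (by norm_num)] at hcompl
  have hq : (numTilings (holeyRect m n (j + 1) a X) : ℚ) * 2 ^ v =
      2 ^ #(holeyCells m n j a X) * numTilings (holeyRect m n j a X) := by
    exact_mod_cast hcompl
  have he : (#(holeyCells m n j a X) : ℤ) = v + e := by omega
  rw [← zpow_natCast 2 #(holeyCells m n j a X), he, zpow_add₀ two_ne_zero, zpow_natCast,
    mul_assoc, mul_comm] at hq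
  exact mul_left_cancel₀ (pow_ne_zero v two_ne_zero) hq

lemma numTilings_holeyRect {m n s : ℕ} {a : Fin s → ℕ} {X : Fin s → ℤ}
    (h : IsWindowFamily m n a X) (hmn : m = n + ∑ i, (a i + 1)) {k : ℕ} (hkm : 2 * k < m)
    (hkn : k ≤ n) (hka : ∀ i, k ≤ a i) :
    (numTilings (holeyRect m n k a X) : ℚ) =
      2 ^ (((k + 1).choose 2 * (s + 1) : ℤ) - k * (m + 1)) *
        numTilings (holeyRect m n 0 a X) := by
  induction k with
  | zero => simp
  | succ j ih =>
    rw [numTilings_holeyRect_succ h hmn (by omega) hkn hka,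
      ih (by omega) (by omega) fun i => (Nat.le_succ j).trans (hka i), ← mul_assoc,
      ← zpow_add₀ two_ne_zero]
    -- It remains to add `j + s * (j + 1) - m` to the exponent for `j`, by Pascal's rule.
    congr 2
    rw [Nat.choose_succ_succ' (j + 1) 1]
    push_cast [Nat.choose_one_right]
    ring

/-! ### From labels on `ℓ'` to columns; here `z` is the first label of a run. -/

lemma run_eq_Icc (a : ℕ) (z : ℤ) : run a (z + (a : ℚ) / 2) = Icc z (z + a) := by
  have h1 : (z : ℚ) + (a : ℚ) / 2 - a / 2 = z := by ring
  have h2 : (z : ℚ) + (a : ℚ) / 2 + a / 2 = ((z + a : ℤ) : ℚ) := by push_cast; ring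
  rw [run, h1, h2, Int.ceil_intCast, Int.floor_intCast]

lemma pointOn_eq (n a : ℕ) (z : ℤ) :
    pointOn n (z + (a : ℚ) / 2) = (2 * z + a - 2 - n, -1) := by
  have h : 2 * ((z : ℚ) + (a : ℚ) / 2 - 1) = ((2 * z + a - 2 : ℤ) : ℚ) := by push_cast; ring
  rw [pointOn, h, Int.floor_intCast]

lemma windowRegion_eq_holeyRect {m n k s : ℕ} {a : Fin s → ℕ} {c : Fin s → ℚ} {z : Fin s → ℤ}
    (hz : ∀ i, c i = z i + (a i : ℚ) / 2) :
    windowRegion m n k a c = holeyRect m n k a fun i => 2 * z i + a i - 2 - n := by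
  simp only [windowRegion, holeyRect, hz, pointOn_eq]

lemma isWindowFamily_of_run {m n s : ℕ} {a : Fin s → ℕ} {c : Fin s → ℚ} {z : Fin s → ℤ}
    (hm : Even m) (hz : ∀ i, c i = z i + (a i : ℚ) / 2)
    (hin : ∀ i, run (a i) (c i) ⊆ Icc 1 ((n : ℤ) + 1))
    (hdisj : ∀ i j, i ≠ j → Disjoint (run (a i) (c i)) (run (a j) (c j))) :
    IsWindowFamily m n a fun i => 2 * z i + a i - 2 - n := by
  simp only [hz, run_eq_Icc] at hin hdisj
  have hlr : ∀ i, 1 ≤ z i ∧ z i + a i ≤ n + 1 := fun i =>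
    (Icc_subset_Icc_iff (by omega)).1 (hin i)
  refine ⟨Nat.even_iff.1 hm, fun i => by omega, fun i => ?_, fun i => ?_, fun i j hij => ?_⟩
  · have := hlr i
    omega
  · have := hlr i
    omega
  · have hd := disjoint_left.1 (hdisj i j hij)
    -- If two intervals meet, the larger of their left ends lies in both.
    have := @hd (max (z i) (z j))
    simp only [mem_Icc] at this
    omega

/-- An odd Aztec rectangle of height `0` and width `a i` is a single row of `a i + 1` squares,
namely the run of labels on `ℓ'`. -/
lemma graphRVerts_eq_holeyRect {m n s : ℕ} {a : Fin s → ℕ} {c : Fin s → ℚ} {z : Fin s → ℤ}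
    (hz : ∀ i, c i = z i + (a i : ℚ) / 2)
    (h : IsWindowFamily m n a fun i => 2 * z i + a i - 2 - n) :
    graphRVerts m n (Icc 1 ((n : ℤ) + 1) \ univ.biUnion fun i => run (a i) (c i)) =
      holeyRect m n 0 a fun i => 2 * z i + a i - 2 - n := by
  have hm := h.height_even
  ext ⟨x, y⟩
  rw [mem_holeyRect h (Nat.zero_le _) (Nat.zero_le _) fun _ => Nat.zero_le _]
  simp only [graphRVerts, mem_filter, mem_aztecRect, mem_sdiff, mem_biUnion, mem_univ, true_and,
    not_exists, hz, run_eq_Icc, mem_Icc, InWindow]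
  constructor
  · rintro ⟨h1, h2⟩
    refine ⟨by omega, by omega, by omega, fun i hi => ?_⟩
    obtain ⟨t, ⟨-, ht⟩, hxt⟩ := h2 (by omega)
    have := ht i
    omega
  · rintro ⟨h1, h2, h3, h4⟩
    refine ⟨by omega, fun hy => ⟨(x + n) / 2 + 1, ⟨by omega, fun i hi => h4 i ?_⟩, by omega⟩⟩
    omega

end OddWindows

theorem theorem3p4 (m k s : ℕ) (hs : 1 ≤ s) (a : Fin s → ℕ) (c : Fin s → ℚ) (n : ℕ)
    (hm : Even m) (hk : 0 < k) (hka : ∀ i, k ≤ a i)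
    -- the frame is the Aztec rectangle of height `m` and positive width `n = m - ∑ (a_i + 1)`
    (hn : 0 < n) (hmn : m = n + ∑ i, (a i + 1))
    -- `c_i` is an integer if `a_i` is even, and half an odd integer if `a_i` is odd
    (hc : ∀ i, ∃ z : ℤ, c i = z + (a i : ℚ) / 2)
    -- the windows lie inside the frame, and the runs `A_i` are mutually disjoint
    (hin : ∀ i, OddWindows.run (a i) (c i) ⊆ Finset.Icc 1 ((n : ℤ) + 1))
    (hdisj : ∀ i j, i ≠ j → Disjoint (OddWindows.run (a i) (c i)) (OddWindows.run (a j) (c j))) :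
    (OddWindows.numTilings (OddWindows.windowRegion m n k a c) : ℚ) =
        (2 : ℚ) ^ (((k + 1).choose 2 * (s + 1) : ℤ) - k * (m + 1)) *
          OddWindows.numTilings (OddWindows.windowRegion m n 0 a c) ∧
      (OddWindows.numTilings (OddWindows.windowRegion m n k a c) : ℚ) =
        (2 : ℚ) ^ (((k + 1).choose 2 * (s + 1) : ℤ) - k * (m + 1)) *
          OddWindows.numPerfectMatchings (OddWindows.graphR m n
            (Finset.Icc 1 ((n : ℤ) + 1) \
              Finset.univ.biUnion fun i => OddWindows.run (a i) (c i))) := by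
  choose z hz using hc
  have hW := OddWindows.isWindowFamily_of_run hm hz hin hdisj
  -- One window suffices: it fits into the frame, so `k ≤ a i ≤ n`, and hence `m ≥ n + a i + 1 > 2 *
  -- k`.
  have hkn : k ≤ n ∧ 2 * k < m := by
    have h1 := hW.left_le ⟨0, hs⟩
    have h2 := hW.le_right ⟨0, hs⟩
    have h3 := hka ⟨0, hs⟩
    have h4 := Finset.single_le_sum (f := fun i => a i + 1) (fun _ _ => Nat.zero_le _)
      (Finset.mem_univ ⟨0, hs⟩)
    omega
  have key := OddWindows.numTilings_holeyRect hW hmn hkn.2 hkn.1 hka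
  have hG := OddWindows.numPerfectMatchings_induce (OddWindows.graphRVerts m n
    (Finset.Icc 1 ((n : ℤ) + 1) \ Finset.univ.biUnion fun i => OddWindows.run (a i) (c i)))
  rw [OddWindows.windowRegion_eq_holeyRect hz, OddWindows.windowRegion_eq_holeyRect hz]
  refine ⟨key, key.trans ?_⟩
  rw [← OddWindows.graphRVerts_eq_holeyRect hz hW, ← hG]
  rfl
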